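/- Let $n\ge 1$, let $\gamma$ be the standard Gaussian measure on $\mathbb R^n$, $d\gamma=(2\pi)^{-n/2}e^{-|x|^2/2}\,dx$, and for a bounded open set $\Omega\subset\mathbb R^n$ with Lipschitz boundary let $$T_\gamma(\Omega)=\sup_{w\in W^{1,2}_0(\Omega,\gamma)\setminus\{0\}}\frac{\left(\int_\Omega w\,d\gamma\right)^2}{\int_\Omega|\nabla w|^2\,d\gamma}$$ be its Gaussian torsional rigidity, where $W^{1,2}_0(\Omega,\gamma)$ is the closure of $C_c^\infty(\Omega)$ in the weighted Sobolev space $W^{1,2}(\Omega,\gamma)$. Let $B_R\subset\mathbb R^n$ be the Euclidean ball of radius $R$ centred at the origin; $T_\gamma(B_R)$ is finite for every $R>0$. (1) For all $n\ge1$, $R_0,R_1>0$ and $t\in[0,1]$, with $R_t=(1-t)R_0+tR_1$, $$T_\gamma(B_{R_t})^{1/3}\le(1-t)\,T_\gamma(B_{R_0})^{1/3}+t\,T_\gamma(B_{R_1})^{1/3}.$$ (2) For $t\in(0,1)$, equality holds in (1) if and only if $R_0=R_1$. (3) The exponent $1/3$ is sharp among exponents independent of the dimension. If $0<\alpha<1/3$,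 then for $n=1$ and every $\delta>0$ there are $R_0,R_1\in(0,\delta)$ and $t\in(0,1)$ with $$T_\gamma(B_{R_t})^{\alpha}>(1-t)\,T_\gamma(B_{R_0})^{\alpha}+t\,T_\gamma(B_{R_1})^{\alpha}.$$ Moreover, for each $n\ge1$ the function $T_n(R)=T_\gamma(B_R)$, $B_R\subset\mathbb R^n$, is $C^2$ on $(0,\infty)$ with $T_n'>0$, and the thresholds $$\alpha_n(R)=1-\frac{T_n(R)\,T_n''(R)}{T_n'(R)^2}$$ (for $\alpha>0$, $(T_n^\alpha)''(R)\ge0$ if and only if $\alpha\ge\alpha_n(R)$) satisfy $$\sup_{n\ge1}\ \sup_{R>0}\alpha_n(R)=\frac13,\qquad \lim_{R\to0^+}\alpha_1(R)=\frac13 .$$ -/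

import Mathlib

open MeasureTheory Set Filter Topology
open scoped ContDiff

noncomputable section

namespace GaussTorsion

/-- The standard Gaussian measure on `ℝⁿ`, with density `(2π)^(-n/2) exp(-|x|²/2)`. -/
def gauss (n : ℕ) : Measure (EuclideanSpace ℝ (Fin n)) :=
  volume.withDensity fun x =>
    ENNReal.ofReal ((2 * Real.pi) ^ (-(n : ℝ) / 2) * Real.exp (-‖x‖ ^ 2 / 2))

/-- `φ ∈ C_c^∞(Ω)`. -/
structure IsTest {n : ℕ} (Ω : Set (EuclideanSpace ℝ (Fin n)))
    (φ : EuclideanSpace ℝ (Fin n) → ℝ) : Prop where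
  smooth : ContDiff ℝ ∞ φ
  compact : HasCompactSupport φ
  supp : tsupport φ ⊆ Ω

/-- `g` is a weak gradient of `w` on `Ω`: in every direction `e`, integration by parts against
test functions holds (with respect to Lebesgue measure). -/
def IsWeakGradient {n : ℕ} (Ω : Set (EuclideanSpace ℝ (Fin n)))
    (w : EuclideanSpace ℝ (Fin n) → ℝ)
    (g : EuclideanSpace ℝ (Fin n) → EuclideanSpace ℝ (Fin n)) : Prop :=
  ∀ φ, IsTest Ω φ → ∀ e : EuclideanSpace ℝ (Fin n),
    ∫ x in Ω, w x * fderiv ℝ φ x e = -∫ x in Ω, inner ℝ (g x) e * φ x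

/-- `w ∈ W^{1,2}(Ω, γ)` with weak gradient `g`. -/
structure MemW12 {n : ℕ} (Ω : Set (EuclideanSpace ℝ (Fin n)))
    (w : EuclideanSpace ℝ (Fin n) → ℝ)
    (g : EuclideanSpace ℝ (Fin n) → EuclideanSpace ℝ (Fin n)) : Prop where
  memLp : MemLp w 2 ((gauss n).restrict Ω)
  memLp_grad : MemLp g 2 ((gauss n).restrict Ω)
  weak : IsWeakGradient Ω w g

/-- `w ∈ W_0^{1,2}(Ω, γ)` with weak gradient `g`, where `W_0^{1,2}(Ω, γ)` is the closure of
`C_c^∞(Ω)` in `W^{1,2}(Ω, γ)`. -/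
structure MemW012 {n : ℕ} (Ω : Set (EuclideanSpace ℝ (Fin n)))
    (w : EuclideanSpace ℝ (Fin n) → ℝ)
    (g : EuclideanSpace ℝ (Fin n) → EuclideanSpace ℝ (Fin n)) : Prop extends MemW12 Ω w g where
  approx : ∃ φ : ℕ → EuclideanSpace ℝ (Fin n) → ℝ, (∀ k, IsTest Ω (φ k)) ∧
    Tendsto (fun k => eLpNorm (fun x => φ k x - w x) 2 ((gauss n).restrict Ω)) atTop (𝓝 0) ∧
    Tendsto (fun k => eLpNorm (fun x => gradient (φ k) x - g x) 2 ((gauss n).restrict Ω))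
      atTop (𝓝 0)

/-- The quotients `(∫_Ω w dγ)² / ∫_Ω |∇w|² dγ` for `w ∈ W_0^{1,2}(Ω, γ)`. For `w = 0` the
quotient is read as `0`, which does not affect the supremum of these nonnegative numbers. -/
def torsionQuotients {n : ℕ} (Ω : Set (EuclideanSpace ℝ (Fin n))) : Set ℝ :=
  {q | ∃ w g, MemW012 Ω w g ∧
    q = (∫ x in Ω, w x ∂(gauss n)) ^ 2 / ∫ x in Ω, ‖g x‖ ^ 2 ∂(gauss n)}

/-- The Gaussian torsional rigidity `T_γ(Ω)`. -/
def torsion {n : ℕ} (Ω : Set (EuclideanSpace ℝ (Fin n))) : ℝ :=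
  sSup (torsionQuotients Ω)

/-- `T_γ(B_R)`, where `B_R` is the ball of radius `R` about the origin of `ℝⁿ`. -/
def ballTorsion (n : ℕ) (R : ℝ) : ℝ :=
  torsion (Metric.ball (0 : EuclideanSpace ℝ (Fin n)) R)

/-- The threshold `α_n(R) = 1 - T T'' / (T')²` with `T(R) = T_γ(B_R)`: for `α > 0`, the second
derivative of `T ^ α` at `R` is nonnegative iff `α ≥ α_n(R)`. -/
def threshold (n : ℕ) (R : ℝ) : ℝ :=
  1 - ballTorsion n R * deriv (deriv (ballTorsion n)) R / deriv (ballTorsion n) R ^ 2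

end GaussTorsion

end

/-! In dimension `n = m + 1` the torsion function `u` of a centred ball, solving `-div(γ∇u) = γ`
with zero boundary values, is radial. One integration gives `-∇u = p(|x|) x` with `p = profile m`,
so the radius enters `u` only through an additive constant. Hence, up to a constant factor, `T(R)`
is the integral over `(0, R)` of a density `D(r) = r^(m+2) p² e^(-r²/2)` that does not depend on
`R`.

That `T` is this energy has two halves. Integration by parts turns `∫ w dγ` into a pairing of `∇w`
with `∇u`, and Cauchy–Schwarz bounds every quotient (`MemW012.sq_integral_le`). Smooth truncations
of `u` are test functions whose quotients reach the bound in the limit (`truncated_energy_le`).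

The sign of `(T^α)''` is that of `α - (1 - T D'/D²)`, where `T` and `D` now omit the common
constant. For `α = 1/3` strict convexity becomes `T > (2/3) D²/D'` (`radialTorsion_lower_bound`).
Both sides vanish at `0`, and the equation `r p' = 1 - (m + 1 - r²) p` makes the derivative of their
difference visibly positive. For `n = 1`, `T` behaves like a multiple of `R³` at `0`; there the
threshold tends to `1/3`, so smaller powers are strictly concave near `0`. -/

noncomputable section

namespace GaussTorsion

/-! ### Truncated Gaussian moments -/

/-- The truncated Gaussian moment `∫₀¹ s ^ m exp (-s² y) ds`. -/
def moment (m : ℕ) (y : ℝ) : ℝ := ∫ s in (0 : ℝ)..1, s ^ m * Real.exp (-(s ^ 2 * y))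

theorem hasDerivAt_moment (m : ℕ) (y : ℝ) :
    HasDerivAt (moment m) (-moment (m + 2) y) y := by
  have h := (intervalIntegral.hasDerivAt_integral_of_dominated_loc_of_deriv_le
    (μ := volume) (a := (0 : ℝ)) (b := 1) (𝕜 := ℝ)
    (F := fun y s => s ^ m * Real.exp (-(s ^ 2 * y)))
    (F' := fun y s => -(s ^ (m + 2) * Real.exp (-(s ^ 2 * y))))
    (bound := fun _ => Real.exp (|y| + 1)) (x₀ := y) (Metric.ball_mem_nhds y one_pos)
    (Eventually.of_forall fun z => (by fun_prop : Continuous _).aestronglyMeasurable)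
    ((by fun_prop : Continuous fun s : ℝ => s ^ m * Real.exp (-(s ^ 2 * y))).intervalIntegrable _ _)
    (by fun_prop : Continuous fun s : ℝ =>
      -(s ^ (m + 2) * Real.exp (-(s ^ 2 * y)))).aestronglyMeasurable
    ?_ (by simp) ?_).2
  · exact h.congr_deriv (by simp [moment])
  · refine Eventually.of_forall fun s hs z hz => ?_
    rw [uIoc_of_le zero_le_one] at hs
    rw [Metric.mem_ball, Real.dist_eq] at hz
    have hs2 : s ^ 2 ≤ 1 := pow_le_one₀ hs.1.le hs.2
    have hz' : |z| ≤ |y| + 1 := by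
      have := abs_sub_abs_le_abs_sub z y
      linarith
    have h1 : -(s ^ 2 * z) ≤ |y| + 1 := by
      have := neg_abs_le z
      nlinarith [sq_nonneg s, abs_nonneg z]
    rw [norm_neg, norm_mul, Real.norm_eq_abs, Real.norm_eq_abs, Real.abs_exp,
      abs_of_nonneg (pow_nonneg hs.1.le _)]
    calc s ^ (m + 2) * Real.exp (-(s ^ 2 * z)) ≤ 1 * Real.exp (|y| + 1) := by
          gcongr
          exact pow_le_one₀ hs.1.le hs.2
      _ = _ := one_mul _
  · refine Eventually.of_forall fun s _ z _ => ?_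
    have := (((hasDerivAt_id z).const_mul (s ^ 2)).neg.exp).const_mul (s ^ m)
    refine this.congr_deriv ?_
    simp only [id, Pi.neg_apply]
    ring

/-- Differentiation raises the index by two, so the induction on the order of smoothness treats all
`m` at once. -/
theorem contDiff_moment (m : ℕ) : ContDiff ℝ ∞ (moment m) := by
  rw [contDiff_infty]
  intro k
  induction k generalizing m with
  | zero =>
    exact contDiff_zero.2 (continuous_iff_continuousAt.2 fun y =>
      (hasDerivAt_moment m y).continuousAt)
  | succ k ih =>
    have hd : deriv (moment m) = fun y => -moment (m + 2) y :=
      funext fun y => (hasDerivAt_moment m y).deriv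
    push_cast
    rw [contDiff_succ_iff_deriv]
    refine ⟨fun y => (hasDerivAt_moment m y).differentiableAt, by simp, ?_⟩
    rw [hd]
    exact (ih (m + 2)).neg

theorem moment_pos (m : ℕ) (y : ℝ) : 0 < moment m y :=
  intervalIntegral.intervalIntegral_pos_of_pos_on
    ((by fun_prop : Continuous _).intervalIntegrable _ _)
    (fun s hs => mul_pos (pow_pos hs.1 m) (Real.exp_pos _)) one_pos

theorem moment_add_two_le (m : ℕ) (y : ℝ) : moment (m + 2) y ≤ moment m y := by
  refine intervalIntegral.integral_mono_on zero_le_one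
    ((by fun_prop : Continuous _).intervalIntegrable _ _)
    ((by fun_prop : Continuous _).intervalIntegrable _ _) fun s hs => ?_
  gcongr ?_ * _
  exact pow_le_pow_of_le_one hs.1 hs.2 (by omega)

/-- Integrate the derivative of `s^(m+1) exp(-s² y)` over `[0, 1]`. This identity yields both the
differential equation for `profile` and the divergence computation in `IsTest.integral_gauss_eq`. -/
theorem moment_recurrence (m : ℕ) (y : ℝ) :
    (m + 1) * moment m y - 2 * y * moment (m + 2) y = Real.exp (-y) := by
  have h : ∫ s in (0 : ℝ)..1, ((m + 1) * (s ^ m * Real.exp (-(s ^ 2 * y))) -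
      2 * y * (s ^ (m + 2) * Real.exp (-(s ^ 2 * y)))) =
      (1 : ℝ) ^ (m + 1) * Real.exp (-(1 ^ 2 * y)) - 0 ^ (m + 1) * Real.exp (-(0 ^ 2 * y)) := by
    refine intervalIntegral.integral_eq_sub_of_hasDerivAt
      (f := fun s : ℝ => s ^ (m + 1) * Real.exp (-(s ^ 2 * y))) (fun s _ => ?_)
      ((by fun_prop : Continuous _).intervalIntegrable _ _)
    have := (hasDerivAt_pow (m + 1) s).mul (((hasDerivAt_pow 2 s).mul_const y).neg.exp)
    refine this.congr_deriv ?_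
    simp only [Pi.neg_apply, Nat.add_sub_cancel]
    push_cast
    ring
  rw [intervalIntegral.integral_sub ((by fun_prop : Continuous _).intervalIntegrable _ _)
    ((by fun_prop : Continuous _).intervalIntegrable _ _),
    intervalIntegral.integral_const_mul, intervalIntegral.integral_const_mul] at h
  simpa [moment] using h

theorem moment_zero_right (m : ℕ) : moment m 0 = 1 / (m + 1) := by
  have h := moment_recurrence m 0
  have : (m + 1 : ℝ) ≠ 0 := by positivity
  field_simp
  simpa [mul_comm] using h

theorem contDiff_primitive {f : ℝ → ℝ} (hf : ContDiff ℝ ∞ f) (a : ℝ) :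
    ContDiff ℝ ∞ fun x => ∫ t in a..x, f t := by
  have hd : ∀ x, HasDerivAt (fun x => ∫ t in a..x, f t) (f x) x := fun x =>
    hf.continuous.integral_hasStrictDerivAt a x |>.hasDerivAt
  have h2 : deriv (fun x => ∫ t in a..x, f t) = f := funext fun x => (hd x).deriv
  refine contDiff_infty_iff_deriv.2 ⟨fun x => (hd x).differentiableAt, ?_⟩
  rwa [h2]

/-! ### The radial profile of the torsion function -/

/-- In dimension `m + 1`, the radial derivative of the torsion function is `-r * profile m r`. -/
def profile (m : ℕ) (r : ℝ) : ℝ := moment m (r ^ 2 / 2) * Real.exp (r ^ 2 / 2)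

theorem contDiff_profile (m : ℕ) : ContDiff ℝ ∞ (profile m) :=
  ((contDiff_moment m).comp (by fun_prop)).mul (by fun_prop)

theorem profile_pos (m : ℕ) (r : ℝ) : 0 < profile m r :=
  mul_pos (moment_pos _ _) (Real.exp_pos _)

theorem profile_zero (m : ℕ) : profile m 0 = 1 / (m + 1) := by
  simp [profile, moment_zero_right]

/-- This is the radial form of the torsion equation; the recurrence eliminates `moment (m + 2)`. -/
theorem hasDerivAt_profile (m : ℕ) {r : ℝ} (hr : 0 < r) :
    HasDerivAt (profile m) ((1 - (m + 1 - r ^ 2) * profile m r) / r) r := by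
  have h0 : HasDerivAt (fun r : ℝ => r ^ 2 / 2) r r := by
    simpa using (hasDerivAt_pow 2 r).div_const 2
  have h := ((hasDerivAt_moment m (r ^ 2 / 2)).comp r h0).mul h0.exp
  refine h.congr_deriv ?_
  have hm := moment_recurrence m (r ^ 2 / 2)
  have he : Real.exp (-(r ^ 2 / 2)) * Real.exp (r ^ 2 / 2) = 1 := by
    rw [← Real.exp_add]; simp
  rw [← hm] at he
  rw [eq_div_iff hr.ne', profile]
  simp only [Function.comp_apply]
  linear_combination he

/-- For `r > 0` this quantity is the derivative of `r * profile m r`. The recurrence rewrites it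
through `moment m` and `moment m - moment (m + 2)`, which have good signs. It keeps the factor `2 -
(m - r²) * profile m r` of `D'` above `1`, even when `r² < m`. -/
theorem profile_slope_pos (m : ℕ) (r : ℝ) : 0 < 1 - (m - r ^ 2) * profile m r := by
  have hm := moment_recurrence m (r ^ 2 / 2)
  have he : Real.exp (-(r ^ 2 / 2)) * Real.exp (r ^ 2 / 2) = 1 := by
    rw [← Real.exp_add]; simp
  rw [← hm] at he
  have h : 1 - (m - r ^ 2) * profile m r = (moment m (r ^ 2 / 2) +
      r ^ 2 * (moment m (r ^ 2 / 2) - moment (m + 2) (r ^ 2 / 2))) * Real.exp (r ^ 2 / 2) := by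
    rw [profile, ← he]; ring
  rw [h]
  have h1 := moment_add_two_le m (r ^ 2 / 2)
  have h2 := moment_pos m (r ^ 2 / 2)
  exact mul_pos (add_pos_of_pos_of_nonneg h2 (mul_nonneg (sq_nonneg r) (sub_nonneg.2 h1)))
    (Real.exp_pos _)

/-- The derivative of `radialTorsion`. -/
def radialDensity (m : ℕ) (r : ℝ) : ℝ := r ^ (m + 2) * profile m r ^ 2 * Real.exp (-(r ^ 2 / 2))

/-- The torsional rigidity of the ball of radius `R` in dimension `m + 1`, up to a positive
constant depending only on `m`. -/
def radialTorsion (m : ℕ) (R : ℝ) : ℝ := ∫ r in (0 : ℝ)..R, radialDensity m r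

theorem contDiff_radialDensity (m : ℕ) : ContDiff ℝ ∞ (radialDensity m) := by
  have := contDiff_profile m
  unfold radialDensity
  fun_prop

theorem contDiff_radialTorsion (m : ℕ) : ContDiff ℝ ∞ (radialTorsion m) :=
  contDiff_primitive (contDiff_radialDensity m) 0

theorem hasDerivAt_radialTorsion (m : ℕ) (r : ℝ) :
    HasDerivAt (radialTorsion m) (radialDensity m r) r :=
  ((contDiff_radialDensity m).continuous.integral_hasStrictDerivAt 0 r).hasDerivAt

theorem radialDensity_pos (m : ℕ) {r : ℝ} (hr : 0 < r) : 0 < radialDensity m r :=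
  mul_pos (mul_pos (pow_pos hr _) (pow_pos (profile_pos m r) 2)) (Real.exp_pos _)

theorem hasDerivAt_radialDensity (m : ℕ) {r : ℝ} (hr : 0 < r) :
    HasDerivAt (radialDensity m) (r ^ (m + 1) * profile m r * Real.exp (-(r ^ 2 / 2)) *
      (2 - (m - r ^ 2) * profile m r)) r := by
  have h0 : HasDerivAt (fun r : ℝ => -(r ^ 2 / 2)) (-r) r := by
    simpa using ((hasDerivAt_pow 2 r).div_const 2).fun_neg
  have h := ((hasDerivAt_pow (m + 2) r).mul ((hasDerivAt_profile m hr).pow 2)).mul h0.exp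
  refine h.congr_deriv ?_
  have hr' := hr.ne'
  simp only [show m + 2 - 1 = m + 1 by omega, Pi.mul_apply, Pi.pow_apply]
  push_cast
  field_simp
  ring

/-- The left side is `(2/3) D²/D'` for `D = radialDensity m`. It vanishes at `0` like the right
side, so comparing derivatives suffices. -/
theorem radialTorsion_lower_bound (m : ℕ) {R : ℝ} (hR : 0 < R) :
    2 / 3 * (R ^ (m + 3) * profile m R ^ 3 * Real.exp (-(R ^ 2 / 2))) /
      (2 - (m - R ^ 2) * profile m R) < radialTorsion m R := by
  set S : ℝ → ℝ := fun r => 2 / 3 * (r ^ (m + 3) * profile m r ^ 3 * Real.exp (-(r ^ 2 / 2))) /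
      (2 - (m - r ^ 2) * profile m r) with hS
  have hd : ∀ r, 0 < 2 - (m - r ^ 2) * profile m r := fun r => by
    linarith [profile_slope_pos m r]
  have hp := (contDiff_profile m).continuous
  have hcont : Continuous fun r => radialTorsion m r - S r := by
    refine (contDiff_radialTorsion m).continuous.sub ?_
    exact Continuous.div (by fun_prop) (by fun_prop) fun r => (hd r).ne'
  have hmono : StrictMonoOn (fun r => radialTorsion m r - S r) (Ici 0) := by
    refine strictMonoOn_of_deriv_pos (convex_Ici 0) hcont.continuousOn fun r hr => ?_
    rw [interior_Ici, mem_Ioi] at hr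
    have h0 : HasDerivAt (fun r : ℝ => -(r ^ 2 / 2)) (-r) r := by
      simpa using ((hasDerivAt_pow 2 r).div_const 2).fun_neg
    have hκ := hasDerivAt_profile m hr
    have h1 := (((hasDerivAt_pow (m + 3) r).mul (hκ.pow 3)).mul h0.exp).const_mul (2 / 3 : ℝ)
    have h2 := (((hasDerivAt_pow 2 r).const_sub (m : ℝ)).mul hκ).const_sub 2
    have h3 := (hasDerivAt_radialTorsion m r).sub (h1.div h2 (hd r).ne')
    -- Substituting the equation for `profile` leaves the numerator `((m - r²) p)² + 2 (m + r²) p²`,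
    -- positive for `r > 0`. This is the heart of the convexity proof.
    have h4 : HasDerivAt (fun r => radialTorsion m r - S r)
        (r ^ (m + 2) * Real.exp (-(r ^ 2 / 2)) * profile m r ^ 2 *
          (((m - r ^ 2) * profile m r) ^ 2 + 2 * (m + r ^ 2) * profile m r ^ 2) /
          (3 * (2 - (m - r ^ 2) * profile m r) ^ 2)) r := by
      refine h3.congr_deriv ?_
      have hr' := hr.ne'
      have hd' := (hd r).ne'
      simp only [radialDensity, show m + 3 - 1 = m + 2 by omega, Pi.mul_apply, Pi.pow_apply]
      push_cast
      generalize hdd : 2 - (m - r ^ 2) * profile m r = d at hd' ⊢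
      field_simp
      rw [← hdd]
      ring
    rw [h4.deriv]
    have := profile_pos m r
    have := hd r
    positivity
  have h := hmono self_mem_Ici hR.le hR
  simp only [hS, radialTorsion, intervalIntegral.integral_same] at h
  simp only [radialTorsion]
  simpa using h

theorem radialTorsion_pos (m : ℕ) {R : ℝ} (hR : 0 < R) : 0 < radialTorsion m R := by
  refine lt_trans ?_ (radialTorsion_lower_bound m hR)
  have := profile_pos m R
  have : 0 < 2 - (m - R ^ 2) * profile m R := by linarith [profile_slope_pos m R]
  positivity

/-- Dividing by `R^(m+3)` isolates the degenerate behaviour at `0`; the second factor is continuous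
there. -/
theorem radialTorsion_quotient (m : ℕ) {R : ℝ} (hR : 0 < R) :
    radialTorsion m R * deriv (radialDensity m) R / radialDensity m R ^ 2 =
      radialTorsion m R / R ^ (m + 3) * ((2 - (m - R ^ 2) * profile m R) /
        (profile m R ^ 3 * Real.exp (-(R ^ 2 / 2)))) := by
  rw [(hasDerivAt_radialDensity m hR).deriv, radialDensity]
  have := (profile_pos m R).ne'
  have hR' := hR.ne'
  field_simp
  ring

theorem two_thirds_lt_radialTorsion_quotient (m : ℕ) {R : ℝ} (hR : 0 < R) :
    2 / 3 < radialTorsion m R * deriv (radialDensity m) R / radialDensity m R ^ 2 := by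
  rw [radialTorsion_quotient m hR]
  have h := radialTorsion_lower_bound m hR
  have hp := profile_pos m R
  have hd : 0 < 2 - (m - R ^ 2) * profile m R := by linarith [profile_slope_pos m R]
  rw [div_lt_iff₀ hd] at h
  rw [div_mul_div_comm, lt_div_iff₀ (by positivity)]
  linarith

/-- Since `profile 0 0 = 1`, l'Hôpital gives `1/3` for the first factor, while the second tends to
`2`. -/
theorem tendsto_radialTorsion_quotient :
    Tendsto (fun R => radialTorsion 0 R * deriv (radialDensity 0) R / radialDensity 0 R ^ 2)
      (𝓝[>] 0) (𝓝 (2 / 3)) := by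
  have hp := (contDiff_profile 0).continuous
  have h1 : Tendsto (fun R => radialTorsion 0 R / R ^ 3) (𝓝[>] 0) (𝓝 (1 / 3)) := by
    refine HasDerivAt.lhopital_zero_nhdsGT (f' := radialDensity 0) (g' := fun r => 3 * r ^ 2)
      (Eventually.of_forall fun r => hasDerivAt_radialTorsion 0 r)
      (Eventually.of_forall fun r => by simpa using hasDerivAt_pow 3 r) ?_ ?_ ?_ ?_
    · filter_upwards [self_mem_nhdsWithin] with r hr
      have : (0 : ℝ) < r := hr
      positivity
    · have := (contDiff_radialTorsion 0).continuous.tendsto 0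
      simp only [radialTorsion, intervalIntegral.integral_same] at this
      exact this.mono_left nhdsWithin_le_nhds
    · have : Tendsto (fun r : ℝ => r ^ 3) (𝓝 0) (𝓝 (0 ^ 3)) := (continuous_pow 3).tendsto 0
      simpa using this.mono_left nhdsWithin_le_nhds
    · have h : Tendsto (fun r => profile 0 r ^ 2 * Real.exp (-(r ^ 2 / 2)) / 3) (𝓝 0)
          (𝓝 (profile 0 0 ^ 2 * Real.exp (-(0 ^ 2 / 2)) / 3)) :=
        (by fun_prop : Continuous _).tendsto 0
      simp only [profile_zero] at h
      norm_num at h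
      refine (h.mono_left nhdsWithin_le_nhds).congr' ?_
      filter_upwards [self_mem_nhdsWithin] with r hr
      have : r ≠ 0 := (mem_Ioi.1 hr).ne'
      simp only [radialDensity]
      field_simp
  have h2 : Tendsto (fun R => (2 - ((0 : ℕ) - R ^ 2) * profile 0 R) /
        (profile 0 R ^ 3 * Real.exp (-(R ^ 2 / 2)))) (𝓝[>] 0) (𝓝 2) := by
    have h : Tendsto (fun R => (2 - ((0 : ℕ) - R ^ 2) * profile 0 R) /
        (profile 0 R ^ 3 * Real.exp (-(R ^ 2 / 2)))) (𝓝 0)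
        (𝓝 ((2 - ((0 : ℕ) - 0 ^ 2) * profile 0 0) / (profile 0 0 ^ 3 * Real.exp (-(0 ^ 2 / 2))))) := by
      refine Continuous.tendsto (Continuous.div (by fun_prop) (by fun_prop) fun r => ?_) 0
      exact (mul_pos (pow_pos (profile_pos 0 r) 3) (Real.exp_pos _)).ne'
    rw [profile_zero] at h
    norm_num at h
    simpa using h.mono_left nhdsWithin_le_nhds
  have h3 := h1.mul h2
  norm_num at h3
  refine h3.congr' ?_
  filter_upwards [self_mem_nhdsWithin] with r hr
  rw [radialTorsion_quotient 0 hr]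
  norm_num

/-! ### The Gaussian measure and integration by parts -/

/-- The density of `gauss n`. -/
def gaussDensity (n : ℕ) (x : EuclideanSpace ℝ (Fin n)) : ℝ :=
  (2 * Real.pi) ^ (-(n : ℝ) / 2) * Real.exp (-‖x‖ ^ 2 / 2)

theorem continuous_gaussDensity (n : ℕ) : Continuous (gaussDensity n) := by
  unfold gaussDensity
  fun_prop

theorem gaussDensity_pos (n : ℕ) (x : EuclideanSpace ℝ (Fin n)) : 0 < gaussDensity n x := by
  unfold gaussDensity
  positivity

instance instIsLocallyFiniteMeasureGauss (n : ℕ) : IsLocallyFiniteMeasure (gauss n) :=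
  IsLocallyFiniteMeasure.withDensity_ofReal (continuous_gaussDensity n)

instance instIsFiniteMeasureGaussBall (n : ℕ) (R : ℝ) :
    IsFiniteMeasure ((gauss n).restrict (Metric.ball (0 : EuclideanSpace ℝ (Fin n)) R)) :=
  isFiniteMeasure_restrict.2 measure_ball_lt_top.ne

theorem integral_gauss {n : ℕ} (f : EuclideanSpace ℝ (Fin n) → ℝ) :
    ∫ x, f x ∂(gauss n) = ∫ x, gaussDensity n x * f x := by
  have hg : gauss n = volume.withDensity fun x => ENNReal.ofReal (gaussDensity n x) := rfl
  rw [hg, integral_withDensity_eq_integral_toReal_smul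
    (continuous_gaussDensity n).measurable.ennreal_ofReal
    (Eventually.of_forall fun x => ENNReal.ofReal_lt_top)]
  refine integral_congr_ae (Eventually.of_forall fun x => ?_)
  simp only [smul_eq_mul]
  rw [ENNReal.toReal_ofReal (gaussDensity_pos n x).le]

/-- The negative gradient of the torsion function of every ball centred at the origin. -/
def torsionField (m : ℕ) (x : EuclideanSpace ℝ (Fin (m + 1))) : EuclideanSpace ℝ (Fin (m + 1)) :=
  profile m ‖x‖ • x

theorem continuous_torsionField (m : ℕ) : Continuous (torsionField m) :=
  ((contDiff_profile m).continuous.comp continuous_norm).smul continuous_id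

theorem IsTest.integrable_mul {n : ℕ} {Ω : Set (EuclideanSpace ℝ (Fin n))}
    {φ f : EuclideanSpace ℝ (Fin n) → ℝ} (hφ : IsTest Ω φ) (hf : Continuous f) :
    Integrable fun x => f x * φ x :=
  (hf.mul hφ.smooth.continuous).integrable_of_hasCompactSupport hφ.compact.mul_left

theorem IsTest.continuous_fderiv {n : ℕ} {Ω : Set (EuclideanSpace ℝ (Fin n))}
    {φ : EuclideanSpace ℝ (Fin n) → ℝ} (hφ : IsTest Ω φ) (e : EuclideanSpace ℝ (Fin n)) :
    Continuous fun x => fderiv ℝ φ x e :=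
  (hφ.smooth.continuous_fderiv (by simp)).clm_apply continuous_const

theorem IsTest.integrable_mul_fderiv {n : ℕ} {Ω : Set (EuclideanSpace ℝ (Fin n))}
    {φ f : EuclideanSpace ℝ (Fin n) → ℝ} (hφ : IsTest Ω φ) (hf : Continuous f)
    (e : EuclideanSpace ℝ (Fin n)) :
    Integrable fun x => f x * fderiv ℝ φ x e :=
  (hf.mul (hφ.continuous_fderiv e)).integrable_of_hasCompactSupport
    (hφ.compact.fderiv_apply ℝ e).mul_left

theorem IsTest.integral_mul_fderiv {n : ℕ} {Ω : Set (EuclideanSpace ℝ (Fin n))}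
    {φ f : EuclideanSpace ℝ (Fin n) → ℝ} (hφ : IsTest Ω φ) (hf : ContDiff ℝ 1 f)
    (e : EuclideanSpace ℝ (Fin n)) :
    ∫ x, f x * fderiv ℝ φ x e = -∫ x, fderiv ℝ f x e * φ x :=
  integral_mul_fderiv_eq_neg_fderiv_mul_of_integrable
    (hφ.integrable_mul ((hf.continuous_fderiv (by simp)).clm_apply continuous_const))
    (hφ.integrable_mul_fderiv hf.continuous e) (hφ.integrable_mul hf.continuous)
    (fun _ _ => hf.differentiable (by simp) _)
    (fun _ _ => hφ.smooth.differentiable (by simp) _)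

theorem hasFDerivAt_half_norm_sq {n : ℕ} (x : EuclideanSpace ℝ (Fin n)) :
    HasFDerivAt (fun x : EuclideanSpace ℝ (Fin n) => ‖x‖ ^ 2 / 2) (innerSL ℝ x) x := by
  have h := ((hasFDerivAt_id x).norm_sq).mul_const (2⁻¹ : ℝ)
  simp only [id, ← div_eq_mul_inv] at h
  refine h.congr_fderiv ?_
  ext y
  simp

theorem contDiff_half_norm_sq (n : ℕ) :
    ContDiff ℝ ∞ (fun x : EuclideanSpace ℝ (Fin n) => ‖x‖ ^ 2 / 2) :=
  (contDiff_norm_sq ℝ).div_const 2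

theorem fderiv_coord_mul_moment (m : ℕ) {n : ℕ} (i : Fin n) (x : EuclideanSpace ℝ (Fin n)) :
    fderiv ℝ (fun x : EuclideanSpace ℝ (Fin n) => x i * moment m (‖x‖ ^ 2 / 2)) x
      (EuclideanSpace.single i 1) =
      moment m (‖x‖ ^ 2 / 2) - x i ^ 2 * moment (m + 2) (‖x‖ ^ 2 / 2) := by
  have h1 : HasFDerivAt (fun x : EuclideanSpace ℝ (Fin n) => x i)
      (EuclideanSpace.proj i : EuclideanSpace ℝ (Fin n) →L[ℝ] ℝ) x :=
    (EuclideanSpace.proj i : EuclideanSpace ℝ (Fin n) →L[ℝ] ℝ).hasFDerivAt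
  have h2 := (hasDerivAt_moment m (‖x‖ ^ 2 / 2)).comp_hasFDerivAt x (hasFDerivAt_half_norm_sq x)
  have h3 : HasFDerivAt (fun x : EuclideanSpace ℝ (Fin n) => x i * moment m (‖x‖ ^ 2 / 2)) _ x :=
    h1.mul h2
  rw [h3.fderiv]
  simp [EuclideanSpace.inner_single_right]
  ring

/-- The Gaussian density times `torsionField` is a constant times `moment m (|x|²/2) x`, whose
divergence is `exp(-|x|²/2)` by the recurrence. Integrate by parts in each coordinate. -/
theorem IsTest.integral_gauss_eq {m : ℕ} {Ω : Set (EuclideanSpace ℝ (Fin (m + 1)))}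
    {φ : EuclideanSpace ℝ (Fin (m + 1)) → ℝ} (hφ : IsTest Ω φ) :
    ∫ x, φ x ∂(gauss (m + 1)) =
      -∫ x, inner ℝ (torsionField m x) (gradient φ x) ∂(gauss (m + 1)) := by
  set C : ℝ := (2 * Real.pi) ^ (-((m + 1 : ℕ) : ℝ) / 2) with hC
  set f : Fin (m + 1) → EuclideanSpace ℝ (Fin (m + 1)) → ℝ :=
    fun i x => x i * moment m (‖x‖ ^ 2 / 2) with hf
  have hfs : ∀ i, ContDiff ℝ 1 (f i) := fun i =>
    ((EuclideanSpace.proj i : EuclideanSpace ℝ (Fin (m + 1)) →L[ℝ] ℝ).contDiff.mul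
      ((contDiff_moment m).comp (contDiff_half_norm_sq _))).of_le (by simp)
  have key : ∑ i, ∫ x, f i x * fderiv ℝ φ x (EuclideanSpace.single i 1) =
      -∑ i, ∫ x, fderiv ℝ (f i) x (EuclideanSpace.single i 1) * φ x := by
    rw [← Finset.sum_neg_distrib]
    exact Finset.sum_congr rfl fun i _ => hφ.integral_mul_fderiv (hfs i) _
  rw [← integral_finsetSum _ fun i _ => hφ.integrable_mul_fderiv (hfs i).continuous _,
    ← integral_finsetSum _ fun i _ => hφ.integrable_mul
      (((hfs i).continuous_fderiv (by simp)).clm_apply continuous_const)] at key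
  have e1 : ∀ x, ∑ i, f i x * fderiv ℝ φ x (EuclideanSpace.single i 1) =
      moment m (‖x‖ ^ 2 / 2) * inner ℝ (gradient φ x) x := fun x => by
    have hx : x = ∑ i, x i • EuclideanSpace.single i (1 : ℝ) := by
      ext j
      simp [Finset.sum_apply, Pi.single_apply]
    rw [inner_gradient_left]
    conv_rhs => rw [show fderiv ℝ φ x x = fderiv ℝ φ x (∑ i, x i • EuclideanSpace.single i (1 : ℝ))
      from congrArg _ hx]
    rw [map_sum, Finset.mul_sum]
    refine Finset.sum_congr rfl fun i _ => ?_
    simp only [hf, map_smul, smul_eq_mul]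
    ring
  have e2 : ∀ x, ∑ i, fderiv ℝ (f i) x (EuclideanSpace.single i 1) * φ x =
      Real.exp (-(‖x‖ ^ 2 / 2)) * φ x := fun x => by
    rw [← Finset.sum_mul, ← moment_recurrence m]
    congr 1
    simp only [hf, fderiv_coord_mul_moment, Finset.sum_sub_distrib, ← Finset.sum_mul]
    rw [← EuclideanSpace.real_norm_sq_eq]
    simp only [Finset.sum_const, Finset.card_univ, Fintype.card_fin, nsmul_eq_mul]
    push_cast
    ring
  simp only [e1, e2] at key
  rw [integral_gauss, integral_gauss]
  have e3 : ∀ x, gaussDensity (m + 1) x * φ x = C * (Real.exp (-(‖x‖ ^ 2 / 2)) * φ x) :=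
    fun x => by rw [gaussDensity, neg_div (2 : ℝ) (‖x‖ ^ 2), mul_assoc]
  -- The growing exponential in `profile` cancels the Gaussian weight.
  have e4 : ∀ x, gaussDensity (m + 1) x * inner ℝ (torsionField m x) (gradient φ x) =
      C * (moment m (‖x‖ ^ 2 / 2) * inner ℝ (gradient φ x) x) := fun x => by
    have he : Real.exp (-(‖x‖ ^ 2 / 2)) * Real.exp (‖x‖ ^ 2 / 2) = 1 := by
      rw [← Real.exp_add]; simp
    rw [gaussDensity, neg_div (2 : ℝ) (‖x‖ ^ 2), torsionField, real_inner_smul_left, profile, real_inner_comm]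
    linear_combination C * moment m (‖x‖ ^ 2 / 2) * inner ℝ (gradient φ x) x * he
  simp only [e3, e4]
  rw [integral_const_mul, integral_const_mul, key]
  ring

theorem IsTest.eq_zero_of_notMem {n : ℕ} {Ω : Set (EuclideanSpace ℝ (Fin n))}
    {φ : EuclideanSpace ℝ (Fin n) → ℝ} (hφ : IsTest Ω φ) {x : EuclideanSpace ℝ (Fin n)}
    (hx : x ∉ Ω) : φ x = 0 :=
  image_eq_zero_of_notMem_tsupport fun h => hx (hφ.supp h)

theorem IsTest.fderiv_eq_zero_of_notMem {n : ℕ} {Ω : Set (EuclideanSpace ℝ (Fin n))}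
    {φ : EuclideanSpace ℝ (Fin n) → ℝ} (hφ : IsTest Ω φ) {x : EuclideanSpace ℝ (Fin n)}
    (hx : x ∉ Ω) : fderiv ℝ φ x = 0 :=
  image_eq_zero_of_notMem_tsupport fun h => hx (hφ.supp (tsupport_fderiv_subset ℝ h))

theorem gradient_eq_zero_iff_fderiv {n : ℕ} {φ : EuclideanSpace ℝ (Fin n) → ℝ}
    {x : EuclideanSpace ℝ (Fin n)} : gradient φ x = 0 ↔ fderiv ℝ φ x = 0 := by
  simp [gradient]

theorem IsTest.continuous_gradient {n : ℕ} {Ω : Set (EuclideanSpace ℝ (Fin n))}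
    {φ : EuclideanSpace ℝ (Fin n) → ℝ} (hφ : IsTest Ω φ) : Continuous (gradient φ) :=
  (InnerProductSpace.toDual ℝ _).symm.continuous.comp (hφ.smooth.continuous_fderiv (by simp))

theorem IsTest.hasCompactSupport_gradient {n : ℕ} {Ω : Set (EuclideanSpace ℝ (Fin n))}
    {φ : EuclideanSpace ℝ (Fin n) → ℝ} (hφ : IsTest Ω φ) : HasCompactSupport (gradient φ) :=
  (hφ.compact.fderiv ℝ).comp_left (map_zero _)

theorem IsTest.setIntegral_gauss_eq {m : ℕ} {Ω : Set (EuclideanSpace ℝ (Fin (m + 1)))}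
    {φ : EuclideanSpace ℝ (Fin (m + 1)) → ℝ} (hφ : IsTest Ω φ) :
    ∫ x in Ω, φ x ∂(gauss (m + 1)) =
      -∫ x in Ω, inner ℝ (torsionField m x) (gradient φ x) ∂(gauss (m + 1)) := by
  rw [setIntegral_eq_integral_of_forall_compl_eq_zero fun x hx => hφ.eq_zero_of_notMem hx,
    setIntegral_eq_integral_of_forall_compl_eq_zero fun x hx => ?_, hφ.integral_gauss_eq]
  rw [gradient_eq_zero_iff_fderiv.2 (hφ.fderiv_eq_zero_of_notMem hx), inner_zero_right]

theorem IsTest.memW012 {n : ℕ} {Ω : Set (EuclideanSpace ℝ (Fin n))}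
    {φ : EuclideanSpace ℝ (Fin n) → ℝ} (hφ : IsTest Ω φ) : MemW012 Ω φ (gradient φ) where
  memLp := (hφ.smooth.continuous.memLp_of_hasCompactSupport hφ.compact).restrict Ω
  memLp_grad :=
    (hφ.continuous_gradient.memLp_of_hasCompactSupport hφ.hasCompactSupport_gradient).restrict Ω
  weak := fun ψ hψ e => by
    simp only [inner_gradient_left]
    rw [setIntegral_eq_integral_of_forall_compl_eq_zero fun x hx => by
        rw [hφ.eq_zero_of_notMem hx, zero_mul],
      setIntegral_eq_integral_of_forall_compl_eq_zero fun x hx => by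
        rw [hψ.eq_zero_of_notMem hx, mul_zero],
      hψ.integral_mul_fderiv (hφ.smooth.of_le (by simp)) e]
  approx := ⟨fun _ => φ, fun _ => hφ, by simp, by simp⟩

/-! ### The upper bound -/

theorem inner_toLp_eq_integral {α E : Type*} [MeasurableSpace α] {μ : Measure α}
    [NormedAddCommGroup E] [InnerProductSpace ℝ E] {f g : α → E} (hf : MemLp f 2 μ)
    (hg : MemLp g 2 μ) :
    inner ℝ (hf.toLp f) (hg.toLp g) = ∫ x, inner ℝ (f x) (g x) ∂μ := by
  rw [L2.inner_def]
  refine integral_congr_ae ?_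
  filter_upwards [hf.coeFn_toLp, hg.coeFn_toLp] with x h1 h2
  rw [h1, h2]

theorem sq_integral_inner_le {α E : Type*} [MeasurableSpace α] {μ : Measure α}
    [NormedAddCommGroup E] [InnerProductSpace ℝ E] {f g : α → E} (hf : MemLp f 2 μ)
    (hg : MemLp g 2 μ) :
    (∫ x, inner ℝ (f x) (g x) ∂μ) ^ 2 ≤ (∫ x, ‖f x‖ ^ 2 ∂μ) * ∫ x, ‖g x‖ ^ 2 ∂μ := by
  have h := real_inner_mul_inner_self_le (hf.toLp f) (hg.toLp g)
  rw [inner_toLp_eq_integral hf hg, inner_toLp_eq_integral hf hf,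
    inner_toLp_eq_integral hg hg, ← sq] at h
  simpa only [real_inner_self_eq_norm_sq] using h

theorem tendsto_eLpNorm_one_of_two {α E : Type*} [MeasurableSpace α] {μ : Measure α}
    [IsFiniteMeasure μ] [NormedAddCommGroup E] {f : ℕ → α → E}
    (hm : ∀ k, AEStronglyMeasurable (f k) μ)
    (h : Tendsto (fun k => eLpNorm (f k) 2 μ) atTop (𝓝 0)) :
    Tendsto (fun k => eLpNorm (f k) 1 μ) atTop (𝓝 0) := by
  set c : ENNReal := μ univ ^ (1 / (1 : ENNReal).toReal - 1 / (2 : ENNReal).toReal) with hc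
  have hc' : c ≠ ⊤ := ENNReal.rpow_ne_top_of_nonneg (by norm_num) (measure_ne_top _ _)
  have h2 : Tendsto (fun k => eLpNorm (f k) 2 μ * c) atTop (𝓝 0) := by
    simpa using ENNReal.Tendsto.mul_const h (Or.inr hc')
  exact tendsto_of_tendsto_of_tendsto_of_le_of_le tendsto_const_nhds h2 (fun _ => zero_le)
    fun k => eLpNorm_le_eLpNorm_mul_rpow_measure_univ (by norm_num) (hm k)

theorem exists_bound_torsionField (m : ℕ) (R : ℝ) :
    ∃ C : ℝ, ∀ x ∈ Metric.ball (0 : EuclideanSpace ℝ (Fin (m + 1))) R, ‖torsionField m x‖ ≤ C := by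
  obtain ⟨C, hC⟩ := (isCompact_closedBall (0 : EuclideanSpace ℝ (Fin (m + 1)))
    R).exists_bound_of_continuousOn (continuous_torsionField m).continuousOn
  exact ⟨C, fun x hx => hC x (Metric.ball_subset_closedBall hx)⟩

theorem memLp_torsionField (m : ℕ) (R : ℝ) :
    MemLp (torsionField m) 2
      ((gauss (m + 1)).restrict (Metric.ball (0 : EuclideanSpace ℝ (Fin (m + 1))) R)) := by
  obtain ⟨C, hC⟩ := exists_bound_torsionField m R
  exact MemLp.of_bound (continuous_torsionField m).aestronglyMeasurable C
    ((ae_restrict_mem measurableSet_ball).mono hC)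

/-- The identity passes to the limit from test functions: on a ball the measure is finite, so L²
convergence implies L¹ convergence, and `torsionField` is bounded. -/
theorem MemW012.integral_eq {m : ℕ} {R : ℝ} {w : EuclideanSpace ℝ (Fin (m + 1)) → ℝ}
    {g : EuclideanSpace ℝ (Fin (m + 1)) → EuclideanSpace ℝ (Fin (m + 1))}
    (h : MemW012 (Metric.ball 0 R) w g) :
    ∫ x in Metric.ball 0 R, w x ∂(gauss (m + 1)) =
      -∫ x in Metric.ball 0 R, inner ℝ (torsionField m x) (g x) ∂(gauss (m + 1)) := by
  obtain ⟨φ, hφ, h1, h2⟩ := h.approx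
  set μ := (gauss (m + 1)).restrict (Metric.ball (0 : EuclideanSpace ℝ (Fin (m + 1))) R)
  obtain ⟨C, hC⟩ := exists_bound_torsionField m R
  have hVc := continuous_torsionField m
  have hw := h.memLp.aestronglyMeasurable
  have hg := h.memLp_grad.aestronglyMeasurable
  have t1 : Tendsto (fun k => ∫ x, φ k x ∂μ) atTop (𝓝 (∫ x, w x ∂μ)) := by
    refine tendsto_integral_of_L1' w hw (Eventually.of_forall fun k =>
      (hφ k).memW012.memLp.integrable (by norm_num)) ?_
    exact tendsto_eLpNorm_one_of_two
      (fun k => (hφ k).memW012.memLp.aestronglyMeasurable.sub hw) h1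
  have t2 : Tendsto (fun k => ∫ x, inner ℝ (torsionField m x) (gradient (φ k) x) ∂μ) atTop
      (𝓝 (∫ x, inner ℝ (torsionField m x) (g x) ∂μ)) := by
    refine tendsto_integral_of_L1' _ (hVc.aestronglyMeasurable.inner hg)
      (Eventually.of_forall fun k => ?_) ?_
    · have hc : Continuous fun x => inner ℝ (torsionField m x) (gradient (φ k) x) :=
        hVc.inner (hφ k).continuous_gradient
      refine (hc.integrable_of_hasCompactSupport (μ := gauss (m + 1)) ?_).restrict
      refine (hφ k).hasCompactSupport_gradient.mono fun x hx => ?_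
      contrapose! hx
      rw [Function.notMem_support] at hx ⊢
      rw [hx, inner_zero_right]
    · have h3 := ENNReal.Tendsto.const_mul (a := ENNReal.ofReal C)
        (tendsto_eLpNorm_one_of_two (μ := μ)
          (fun k => (hφ k).memW012.memLp_grad.aestronglyMeasurable.sub hg) h2)
        (Or.inr ENNReal.ofReal_ne_top)
      rw [mul_zero] at h3
      refine tendsto_of_tendsto_of_tendsto_of_le_of_le tendsto_const_nhds h3
        (fun _ => zero_le) fun k => ?_
      refine eLpNorm_le_mul_eLpNorm_of_ae_le_mul ?_ 1
      filter_upwards [ae_restrict_mem measurableSet_ball] with x hx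
      simp only [Pi.sub_apply, ← inner_sub_right]
      exact (norm_inner_le_norm _ _).trans
        (mul_le_mul_of_nonneg_right (hC x hx) (norm_nonneg _))
  refine tendsto_nhds_unique t1 (t2.neg.congr fun k => ?_)
  exact (hφ k).setIntegral_gauss_eq.symm

/-- The energy of the torsion function of the ball of radius `R`. -/
def torsionEnergy (m : ℕ) (R : ℝ) : ℝ :=
  ∫ x in Metric.ball (0 : EuclideanSpace ℝ (Fin (m + 1))) R,
    ‖torsionField m x‖ ^ 2 ∂(gauss (m + 1))

theorem MemW012.sq_integral_le {m : ℕ} {R : ℝ} {w : EuclideanSpace ℝ (Fin (m + 1)) → ℝ}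
    {g : EuclideanSpace ℝ (Fin (m + 1)) → EuclideanSpace ℝ (Fin (m + 1))}
    (h : MemW012 (Metric.ball 0 R) w g) :
    (∫ x in Metric.ball 0 R, w x ∂(gauss (m + 1))) ^ 2 ≤
      torsionEnergy m R * ∫ x in Metric.ball 0 R, ‖g x‖ ^ 2 ∂(gauss (m + 1)) := by
  rw [h.integral_eq, neg_sq]
  exact sq_integral_inner_le (memLp_torsionField m R) h.memLp_grad

theorem torsionEnergy_nonneg (m : ℕ) (R : ℝ) : 0 ≤ torsionEnergy m R :=
  integral_nonneg fun _ => by positivity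

theorem torsionEnergy_mem_upperBounds (m : ℕ) (R : ℝ) :
    torsionEnergy m R ∈
      upperBounds (torsionQuotients (Metric.ball (0 : EuclideanSpace ℝ (Fin (m + 1))) R)) := by
  rintro q ⟨w, g, h, rfl⟩
  -- This form also covers a zero denominator, where the quotient is `0`.
  exact div_le_of_le_mul₀ (integral_nonneg fun _ => by positivity) (torsionEnergy_nonneg m R)
    h.sq_integral_le

/-! ### The lower bound -/

/-- A smooth approximation of the positive part, with derivative in `[0, 1]`, that vanishes on
`(-∞, ε]`. -/
def smoothPart (ε s : ℝ) : ℝ := ∫ t in (0 : ℝ)..s, Real.smoothTransition ((t - ε) / ε)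

theorem contDiff_smoothTransition_rescaled (ε : ℝ) :
    ContDiff ℝ ∞ fun t : ℝ => Real.smoothTransition ((t - ε) / ε) :=
  Real.smoothTransition.contDiff.comp (by fun_prop)

theorem hasDerivAt_smoothPart (ε s : ℝ) :
    HasDerivAt (smoothPart ε) (Real.smoothTransition ((s - ε) / ε)) s :=
  ((contDiff_smoothTransition_rescaled ε).continuous.integral_hasStrictDerivAt 0 s).hasDerivAt

theorem smoothPart_eq_zero {ε s : ℝ} (hε : 0 < ε) (hs : s ≤ ε) : smoothPart ε s = 0 := by
  refine (intervalIntegral.integral_congr (g := fun _ => 0) fun t ht => ?_).trans (by simp)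
  have ht' : t ≤ ε := ht.2.trans (max_le hε.le hs)
  exact Real.smoothTransition.zero_of_nonpos
    (div_nonpos_of_nonpos_of_nonneg (sub_nonpos.2 ht') hε.le)

/-- The torsion function of the ball of radius `R`. -/
def torsionFunction (m : ℕ) (R : ℝ) (x : EuclideanSpace ℝ (Fin (m + 1))) : ℝ :=
  -∫ y in (R ^ 2 / 2)..(‖x‖ ^ 2 / 2), moment m y * Real.exp y

theorem contDiff_torsionFunction (m : ℕ) (R : ℝ) : ContDiff ℝ ∞ (torsionFunction m R) :=
  ((contDiff_primitive ((contDiff_moment m).mul Real.contDiff_exp) _).comp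
    (contDiff_half_norm_sq _)).neg

theorem hasGradientAt_torsionFunction (m : ℕ) (R : ℝ) (x : EuclideanSpace ℝ (Fin (m + 1))) :
    HasGradientAt (torsionFunction m R) (-torsionField m x) x := by
  have h1 : HasDerivAt (fun z => ∫ y in (R ^ 2 / 2)..z, moment m y * Real.exp y)
      (moment m (‖x‖ ^ 2 / 2) * Real.exp (‖x‖ ^ 2 / 2)) (‖x‖ ^ 2 / 2) :=
    (((contDiff_moment m).mul Real.contDiff_exp).continuous.integral_hasStrictDerivAt
      _ _).hasDerivAt
  rw [hasGradientAt_iff_hasFDerivAt]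
  refine ((h1.comp_hasFDerivAt x (hasFDerivAt_half_norm_sq x)).neg).congr_fderiv ?_
  ext y
  simp [torsionField, profile]

theorem torsionFunction_pos {m : ℕ} {R : ℝ} {x : EuclideanSpace ℝ (Fin (m + 1))}
    (hx : x ∈ Metric.ball 0 R) : 0 < torsionFunction m R x := by
  rw [mem_ball_zero_iff] at hx
  rw [torsionFunction, ← intervalIntegral.integral_symm]
  refine intervalIntegral.intervalIntegral_pos_of_pos
    (((contDiff_moment m).mul Real.contDiff_exp).continuous.intervalIntegrable _ _)
    (fun y => mul_pos (moment_pos m y) (Real.exp_pos y)) ?_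
  gcongr

theorem torsionFunction_nonpos {m : ℕ} {R : ℝ} (hR : 0 < R) {x : EuclideanSpace ℝ (Fin (m + 1))}
    (hx : x ∉ Metric.ball 0 R) : torsionFunction m R x ≤ 0 := by
  rw [mem_ball_zero_iff, not_lt] at hx
  rw [torsionFunction, neg_nonpos]
  refine intervalIntegral.integral_nonneg (by gcongr)
    fun y _ => (mul_pos (moment_pos m y) (Real.exp_pos y)).le

/-- Truncation at a positive level puts the support in the closed set where `u ≥ ε`. That set lies
in the ball because the formula for `u` is nonpositive outside it. -/
theorem isTest_smoothPart_torsionFunction (m : ℕ) {R ε : ℝ} (hR : 0 < R) (hε : 0 < ε) :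
    IsTest (Metric.ball 0 R) fun x => smoothPart ε (torsionFunction m R x) := by
  have hu := contDiff_torsionFunction m R
  have hcl : IsClosed {x | ε ≤ torsionFunction m R x} := isClosed_le continuous_const hu.continuous
  have hsub : {x | ε ≤ torsionFunction m R x} ⊆ Metric.ball 0 R := fun x hx => by
    by_contra hxb
    exact absurd (torsionFunction_nonpos hR hxb) (not_le.2 (hε.trans_le hx))
  have hts : tsupport (fun x => smoothPart ε (torsionFunction m R x)) ⊆
      {x | ε ≤ torsionFunction m R x} := closure_minimal (fun x hx => by
    by_contra hxe
    exact hx (smoothPart_eq_zero hε (not_le.1 hxe).le)) hcl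
  refine ⟨(contDiff_primitive (contDiff_smoothTransition_rescaled ε) 0).comp hu, ?_,
    hts.trans hsub⟩
  exact (isCompact_closedBall 0 R).of_isClosed_subset (isClosed_tsupport _)
    ((hts.trans hsub).trans Metric.ball_subset_closedBall)

theorem gradient_smoothPart_torsionFunction (m : ℕ) (R ε : ℝ)
    (x : EuclideanSpace ℝ (Fin (m + 1))) :
    gradient (fun x => smoothPart ε (torsionFunction m R x)) x =
      -(Real.smoothTransition ((torsionFunction m R x - ε) / ε) • torsionField m x) := by
  refine HasGradientAt.gradient ?_
  rw [hasGradientAt_iff_hasFDerivAt]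
  refine ((hasDerivAt_smoothPart ε _).comp_hasFDerivAt x
    (hasGradientAt_torsionFunction m R x).hasFDerivAt).congr_fderiv ?_
  ext y
  simp

/-- With cutoff `η` in `[0, 1]`, the truncation has integral `N = ∫ η |∇u|²` and Dirichlet energy `D
= ∫ η² |∇u|² ≤ N`, so its quotient `N²/D` is at least `N`. Membership of `u` itself in the Sobolev
space is never needed. -/
theorem truncated_energy_le (m : ℕ) {R ε b : ℝ} (hR : 0 < R) (hε : 0 < ε)
    (hb : b ∈ upperBounds (torsionQuotients (Metric.ball (0 : EuclideanSpace ℝ (Fin (m + 1))) R))) :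
    ∫ x in Metric.ball 0 R, Real.smoothTransition ((torsionFunction m R x - ε) / ε) *
      ‖torsionField m x‖ ^ 2 ∂(gauss (m + 1)) ≤ b := by
  have hφ := isTest_smoothPart_torsionFunction m hR hε
  have hq := hb ⟨_, _, hφ.memW012, rfl⟩
  have hCS := hφ.memW012.sq_integral_le
  set η : EuclideanSpace ℝ (Fin (m + 1)) → ℝ :=
    fun x => Real.smoothTransition ((torsionFunction m R x - ε) / ε) with hη
  have hηc : Continuous η :=
    (contDiff_smoothTransition_rescaled ε).continuous.comp (contDiff_torsionFunction m R).continuous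
  have hVc := continuous_torsionField m
  have hint : ∀ f : EuclideanSpace ℝ (Fin (m + 1)) → ℝ, Continuous f →
      IntegrableOn f (Metric.ball 0 R) (gauss (m + 1)) := fun f hf =>
    (hf.continuousOn.integrableOn_compact (isCompact_closedBall 0 R)).mono_set
      Metric.ball_subset_closedBall
  have hN : ∫ x in Metric.ball 0 R, smoothPart ε (torsionFunction m R x) ∂(gauss (m + 1)) =
      ∫ x in Metric.ball 0 R, η x * ‖torsionField m x‖ ^ 2 ∂(gauss (m + 1)) := by
    rw [hφ.setIntegral_gauss_eq, ← integral_neg]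
    refine integral_congr_ae (Eventually.of_forall fun x => ?_)
    simp only [gradient_smoothPart_torsionFunction, inner_neg_right, neg_neg,
      real_inner_smul_right, real_inner_self_eq_norm_sq, hη]
  have hD : ∫ x in Metric.ball 0 R,
        ‖gradient (fun x => smoothPart ε (torsionFunction m R x)) x‖ ^ 2 ∂(gauss (m + 1)) ≤
      ∫ x in Metric.ball 0 R, η x * ‖torsionField m x‖ ^ 2 ∂(gauss (m + 1)) := by
    simp only [gradient_smoothPart_torsionFunction, norm_neg, norm_smul, mul_pow]
    refine integral_mono (hint _ ((hηc.norm.pow 2).mul (by fun_prop))) (hint _ (by fun_prop)) fun x => ?_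
    refine mul_le_mul_of_nonneg_right ?_ (by positivity)
    have h0 := Real.smoothTransition.nonneg ((torsionFunction m R x - ε) / ε)
    have h1 := Real.smoothTransition.le_one ((torsionFunction m R x - ε) / ε)
    simp only [Real.norm_eq_abs, sq_abs, hη]
    nlinarith
  rw [hN] at hq hCS
  set N := ∫ x in Metric.ball 0 R, η x * ‖torsionField m x‖ ^ 2 ∂(gauss (m + 1))
  set D := ∫ x in Metric.ball 0 R,
        ‖gradient (fun x => smoothPart ε (torsionFunction m R x)) x‖ ^ 2 ∂(gauss (m + 1))
  have hD0 : 0 ≤ D := integral_nonneg fun _ => by positivity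
  refine le_trans ?_ hq
  rcases hD0.eq_or_lt with h | h
  -- If `D = 0` the quotient is `0` by convention, but Cauchy–Schwarz then forces `N = 0`.
  · rw [← h, mul_zero] at hCS
    rw [pow_eq_zero_iff two_ne_zero |>.1 (le_antisymm hCS (sq_nonneg N))]
    positivity
  · rw [le_div_iff₀ h, sq]
    exact mul_le_mul_of_nonneg_left hD (hD0.trans hD)

theorem torsionEnergy_le (m : ℕ) {R b : ℝ} (hR : 0 < R)
    (hb : b ∈ upperBounds (torsionQuotients (Metric.ball (0 : EuclideanSpace ℝ (Fin (m + 1))) R))) :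
    torsionEnergy m R ≤ b := by
  have hVc := continuous_torsionField m
  have hlim : Tendsto (fun k : ℕ => ∫ x in Metric.ball 0 R,
      Real.smoothTransition ((torsionFunction m R x - 1 / ((k : ℝ) + 1)) / (1 / ((k : ℝ) + 1))) *
        ‖torsionField m x‖ ^ 2 ∂(gauss (m + 1))) atTop (𝓝 (torsionEnergy m R)) := by
    refine tendsto_integral_of_dominated_convergence (fun x => ‖torsionField m x‖ ^ 2)
      (fun k => ?_) (memLp_torsionField m R).norm.integrable_sq (fun k => ?_) ?_
    · refine Continuous.aestronglyMeasurable ?_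
      exact ((contDiff_smoothTransition_rescaled _).continuous.comp
        (contDiff_torsionFunction m R).continuous).mul (by fun_prop)
    · refine Eventually.of_forall fun x => ?_
      rw [norm_mul, Real.norm_of_nonneg (Real.smoothTransition.nonneg _),
        Real.norm_of_nonneg (by positivity)]
      exact mul_le_of_le_one_left (by positivity) (Real.smoothTransition.le_one _)
    · filter_upwards [ae_restrict_mem measurableSet_ball] with x hx
      refine tendsto_const_nhds.congr' ?_
      -- Once `2ε < u(x)` the cutoff equals `1` at `x`, so the pointwise limit is eventually
      -- constant.
      have hu := half_pos (torsionFunction_pos hx)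
      filter_upwards [tendsto_one_div_add_atTop_nhds_zero_nat.eventually_lt_const hu] with k hk
      have hk0 : (0 : ℝ) < 1 / ((k : ℝ) + 1) := by positivity
      rw [Real.smoothTransition.one_of_one_le, one_mul]
      rw [one_le_div hk0]
      linarith
  exact le_of_tendsto' hlim fun k => truncated_energy_le m hR (by positivity) hb

theorem isLUB_torsionEnergy (m : ℕ) {R : ℝ} (hR : 0 < R) :
    IsLUB (torsionQuotients (Metric.ball (0 : EuclideanSpace ℝ (Fin (m + 1))) R))
      (torsionEnergy m R) :=
  ⟨torsionEnergy_mem_upperBounds m R, fun _ hb => torsionEnergy_le m hR hb⟩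

theorem ballTorsion_eq_torsionEnergy (m : ℕ) {R : ℝ} (hR : 0 < R) :
    ballTorsion (m + 1) R = torsionEnergy m R := by
  refine (isLUB_torsionEnergy m hR).csSup_eq ?_
  exact ⟨_, _, _, (isTest_smoothPart_torsionFunction m hR one_pos).memW012, rfl⟩

/-- The ratio of `ballTorsion (m + 1)` to `radialTorsion m`. -/
def ballConstant (m : ℕ) : ℝ :=
  (2 * Real.pi) ^ (-((m + 1 : ℕ) : ℝ) / 2) *
    ((m + 1 : ℕ) * volume.real (Metric.ball (0 : EuclideanSpace ℝ (Fin (m + 1))) 1))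

theorem ballConstant_pos (m : ℕ) : 0 < ballConstant m := by
  have : 0 < volume.real (Metric.ball (0 : EuclideanSpace ℝ (Fin (m + 1))) 1) :=
    ENNReal.toReal_pos (Metric.measure_ball_pos _ _ one_pos).ne' measure_ball_lt_top.ne
  unfold ballConstant
  positivity

/-- Polar coordinates: the sphere contributes `r^m` and the squared field `r² p²`. -/
theorem ballTorsion_eq (m : ℕ) {R : ℝ} (hR : 0 < R) :
    ballTorsion (m + 1) R = ballConstant m * radialTorsion m R := by
  rw [ballTorsion_eq_torsionEnergy m hR, torsionEnergy, ← integral_indicator measurableSet_ball,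
    integral_gauss]
  set C : ℝ := (2 * Real.pi) ^ (-((m + 1 : ℕ) : ℝ) / 2)
  set f : ℝ → ℝ := (Iio R).indicator
    fun r => profile m r ^ 2 * r ^ 2 * Real.exp (-(r ^ 2 / 2)) with hf
  have h1 : ∀ x : EuclideanSpace ℝ (Fin (m + 1)), gaussDensity (m + 1) x *
      (Metric.ball 0 R).indicator (fun x => ‖torsionField m x‖ ^ 2) x = C * f ‖x‖ := fun x => by
    by_cases hx : ‖x‖ < R
    · rw [indicator_of_mem (mem_ball_zero_iff.2 hx), hf, indicator_of_mem (mem_Iio.2 hx),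
        gaussDensity, neg_div (2 : ℝ) (‖x‖ ^ 2), torsionField, norm_smul, mul_pow,
        Real.norm_of_nonneg (profile_pos m _).le]
      ring
    · rw [indicator_of_notMem (by rwa [mem_ball_zero_iff]), hf,
        indicator_of_notMem (by rwa [mem_Iio]), mul_zero, mul_zero]
  simp only [h1]
  rw [integral_const_mul, integral_fun_norm_addHaar, finrank_euclideanSpace_fin]
  have h2 : ∫ y in Ioi (0 : ℝ), y ^ (m + 1 - 1) • f y = radialTorsion m R := by
    have h3 : ∀ y : ℝ, y ^ (m + 1 - 1) • f y = (Iio R).indicator (radialDensity m) y := fun y => by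
      simp only [hf, indicator, radialDensity, Nat.add_sub_cancel, smul_eq_mul]
      split_ifs <;> ring
    simp only [h3]
    rw [setIntegral_indicator measurableSet_Iio, Ioi_inter_Iio, ← integral_Ioc_eq_integral_Ioo,
      ← intervalIntegral.integral_of_le hR.le, radialTorsion]
  rw [h2, ballConstant]
  simp only [nsmul_eq_mul, smul_eq_mul]
  ring

/-! ### Derivatives of the torsional rigidity -/

theorem ballTorsion_pos (m : ℕ) {R : ℝ} (hR : 0 < R) : 0 < ballTorsion (m + 1) R := by
  rw [ballTorsion_eq m hR]
  exact mul_pos (ballConstant_pos m) (radialTorsion_pos m hR)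

/-- The formula for `ballTorsion` is available only at positive radii, so the derivative is
transferred by equality near `R`. -/
theorem hasDerivAt_ballTorsion (m : ℕ) {R : ℝ} (hR : 0 < R) :
    HasDerivAt (ballTorsion (m + 1)) (ballConstant m * radialDensity m R) R :=
  ((hasDerivAt_radialTorsion m R).const_mul (ballConstant m)).congr_of_eventuallyEq
    ((eventually_gt_nhds hR).mono fun _ hr => ballTorsion_eq m hr)

theorem deriv_ballTorsion_pos (m : ℕ) {R : ℝ} (hR : 0 < R) :
    0 < deriv (ballTorsion (m + 1)) R := by
  rw [(hasDerivAt_ballTorsion m hR).deriv]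
  exact mul_pos (ballConstant_pos m) (radialDensity_pos m hR)

theorem hasDerivAt_deriv_ballTorsion (m : ℕ) {R : ℝ} (hR : 0 < R) :
    HasDerivAt (deriv (ballTorsion (m + 1)))
      (ballConstant m * deriv (radialDensity m) R) R :=
  ((hasDerivAt_radialDensity m hR).differentiableAt.hasDerivAt.const_mul
    (ballConstant m)).congr_of_eventuallyEq
    ((eventually_gt_nhds hR).mono fun _ hr => (hasDerivAt_ballTorsion m hr).deriv)

theorem contDiffOn_ballTorsion (m : ℕ) : ContDiffOn ℝ 2 (ballTorsion (m + 1)) (Ioi 0) := by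
  have h : ContDiff ℝ ∞ fun R => ballConstant m * radialTorsion m R :=
    contDiff_const.mul (contDiff_radialTorsion m)
  exact (contDiff_infty.1 h 2).contDiffOn.congr fun R hR => ballTorsion_eq m hR

theorem threshold_eq (m : ℕ) {R : ℝ} (hR : 0 < R) :
    threshold (m + 1) R =
      1 - radialTorsion m R * deriv (radialDensity m) R / radialDensity m R ^ 2 := by
  rw [threshold, (hasDerivAt_deriv_ballTorsion m hR).deriv, (hasDerivAt_ballTorsion m hR).deriv,
    ballTorsion_eq m hR]
  have hc := (ballConstant_pos m).ne'
  have hd := (radialDensity_pos m hR).ne'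
  field_simp

theorem threshold_lt (m : ℕ) {R : ℝ} (hR : 0 < R) : threshold (m + 1) R < 1 / 3 := by
  rw [threshold_eq m hR]
  linarith [two_thirds_lt_radialTorsion_quotient m hR]

theorem tendsto_threshold_one : Tendsto (threshold 1) (𝓝[>] 0) (𝓝 (1 / 3)) := by
  have h := tendsto_radialTorsion_quotient.const_sub 1
  norm_num at h
  refine h.congr' ?_
  filter_upwards [self_mem_nhdsWithin] with R hR
  exact (threshold_eq 0 hR).symm

/-- All factors but the last are positive for `α > 0`, so the threshold alone decides convexity. -/
theorem deriv2_ballTorsion_rpow (m : ℕ) (α : ℝ) {R : ℝ} (hR : 0 < R) :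
    deriv^[2] (fun r => ballTorsion (m + 1) r ^ α) R =
      α * ballTorsion (m + 1) R ^ (α - 2) * deriv (ballTorsion (m + 1)) R ^ 2 *
        (α - threshold (m + 1) R) := by
  have h1 : ∀ r : ℝ, 0 < r → HasDerivAt (fun r => ballTorsion (m + 1) r ^ α)
      (deriv (ballTorsion (m + 1)) r * α * ballTorsion (m + 1) r ^ (α - 1)) r := fun r hr =>
    (hasDerivAt_ballTorsion m hr).differentiableAt.hasDerivAt.rpow_const
      (Or.inl (ballTorsion_pos m hr).ne')
  have hT := ballTorsion_pos m hR
  have h2 := ((hasDerivAt_deriv_ballTorsion m hR).differentiableAt.hasDerivAt.mul_const α).mul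
    ((hasDerivAt_ballTorsion m hR).differentiableAt.hasDerivAt.rpow_const (p := α - 1)
      (Or.inl hT.ne'))
  have h3 := h2.congr_of_eventuallyEq
    ((eventually_gt_nhds hR).mono fun r hr => (h1 r hr).deriv)
  rw [Function.iterate_succ, Function.iterate_one, Function.comp_apply, h3.deriv, threshold]
  have hd := (deriv_ballTorsion_pos m hR).ne'
  have hp : ballTorsion (m + 1) R ^ (α - 1) =
      ballTorsion (m + 1) R ^ (α - 2) * ballTorsion (m + 1) R := by
    rw [← Real.rpow_add_one hT.ne']
    ring_nf
  rw [hp, show α - 1 - 1 = α - 2 by ring]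
  field_simp
  ring

/-! ### Convexity and concavity of powers of the torsional rigidity -/

theorem continuousOn_ballTorsion_rpow (m : ℕ) (α : ℝ) :
    ContinuousOn (fun r => ballTorsion (m + 1) r ^ α) (Ioi 0) :=
  (contDiffOn_ballTorsion m).continuousOn.rpow_const fun _ hr => Or.inl (ballTorsion_pos m hr).ne'

theorem strictConvexOn_ballTorsion_rpow (m : ℕ) :
    StrictConvexOn ℝ (Ioi 0) fun r => ballTorsion (m + 1) r ^ (1 / 3 : ℝ) := by
  refine strictConvexOn_of_deriv2_pos' (convex_Ioi 0) (continuousOn_ballTorsion_rpow m _)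
    fun R hR => ?_
  rw [deriv2_ballTorsion_rpow m _ hR]
  have h1 := Real.rpow_pos_of_pos (ballTorsion_pos m hR) (1 / 3 - 2)
  have h2 := deriv_ballTorsion_pos m hR
  have h3 := sub_pos.2 (threshold_lt m hR)
  positivity

/-- The one-dimensional threshold tends to `1/3`, hence exceeds `α` at all small radii. -/
theorem exists_strictConcaveOn_ballTorsion_rpow {α : ℝ} (h0 : 0 < α) (hα : α < 1 / 3) :
    ∃ ρ > 0, StrictConcaveOn ℝ (Ioo 0 ρ) fun r => ballTorsion 1 r ^ α := by
  obtain ⟨ρ, hρ, h⟩ := mem_nhdsGT_iff_exists_Ioo_subset.1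
    (tendsto_threshold_one.eventually_const_lt hα)
  refine ⟨ρ, hρ, strictConcaveOn_of_deriv2_neg' (convex_Ioo 0 ρ)
    ((continuousOn_ballTorsion_rpow 0 α).mono Ioo_subset_Ioi_self) fun R hR => ?_⟩
  rw [deriv2_ballTorsion_rpow 0 _ hR.1]
  have h1 := Real.rpow_pos_of_pos (ballTorsion_pos 0 hR.1) (α - 2)
  have h2 := deriv_ballTorsion_pos 0 hR.1
  exact mul_neg_of_pos_of_neg (by positivity) (sub_neg.2 (h hR))

end GaussTorsion

end

/-! ### The main theorem -/

open GaussTorsion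

theorem theorem1p2 :
    -- for every ball the supremum defining the torsional rigidity is finite
    (∀ n : ℕ, 1 ≤ n → ∀ R : ℝ, 0 < R →
      BddAbove (GaussTorsion.torsionQuotients (Metric.ball (0 : EuclideanSpace ℝ (Fin n)) R))) ∧
    -- convexity of the cube root
    (∀ n : ℕ, 1 ≤ n → ∀ R₀ R₁ t : ℝ, 0 < R₀ → 0 < R₁ → t ∈ Set.Icc (0 : ℝ) 1 →
      GaussTorsion.ballTorsion n ((1 - t) * R₀ + t * R₁) ^ (1 / 3 : ℝ) ≤
        (1 - t) * GaussTorsion.ballTorsion n R₀ ^ (1 / 3 : ℝ) +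
          t * GaussTorsion.ballTorsion n R₁ ^ (1 / 3 : ℝ)) ∧
    -- the equality case
    (∀ n : ℕ, 1 ≤ n → ∀ R₀ R₁ t : ℝ, 0 < R₀ → 0 < R₁ → t ∈ Set.Ioo (0 : ℝ) 1 →
      (GaussTorsion.ballTorsion n ((1 - t) * R₀ + t * R₁) ^ (1 / 3 : ℝ) =
        (1 - t) * GaussTorsion.ballTorsion n R₀ ^ (1 / 3 : ℝ) +
          t * GaussTorsion.ballTorsion n R₁ ^ (1 / 3 : ℝ) ↔ R₀ = R₁)) ∧
    -- sharpness: no smaller positive exponent works, already for small balls of dimension one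
    (∀ α : ℝ, 0 < α → α < 1 / 3 → ∀ δ : ℝ, 0 < δ →
      ∃ R₀ ∈ Set.Ioo (0 : ℝ) δ, ∃ R₁ ∈ Set.Ioo (0 : ℝ) δ, ∃ t ∈ Set.Ioo (0 : ℝ) 1,
        (1 - t) * GaussTorsion.ballTorsion 1 R₀ ^ α + t * GaussTorsion.ballTorsion 1 R₁ ^ α <
          GaussTorsion.ballTorsion 1 ((1 - t) * R₀ + t * R₁) ^ α) ∧
    -- the threshold exponents: they are well defined, their supremum over all dimensions and
    -- radii is `1/3`, and it is approached for `n = 1`, `R → 0⁺`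
    (∀ n : ℕ, 1 ≤ n → ContDiffOn ℝ 2 (GaussTorsion.ballTorsion n) (Set.Ioi 0) ∧
      ∀ R : ℝ, 0 < R → 0 < deriv (GaussTorsion.ballTorsion n) R) ∧
    IsLUB {a : ℝ | ∃ n : ℕ, 1 ≤ n ∧ ∃ R : ℝ, 0 < R ∧ a = GaussTorsion.threshold n R} (1 / 3) ∧
    Filter.Tendsto (GaussTorsion.threshold 1) (nhdsWithin 0 (Set.Ioi 0)) (nhds (1 / 3)) := by
  have hsucc : ∀ n : ℕ, 1 ≤ n → ∃ m, n = m + 1 := fun n hn => ⟨n - 1, by omega⟩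
  refine ⟨?_, ?_, ?_, ?_, ?_, ⟨?_, ?_⟩, tendsto_threshold_one⟩
  · intro n hn R hR
    obtain ⟨m, rfl⟩ := hsucc n hn
    exact ⟨_, torsionEnergy_mem_upperBounds m R⟩
  · intro n hn R₀ R₁ t h₀ h₁ ht
    obtain ⟨m, rfl⟩ := hsucc n hn
    exact (strictConvexOn_ballTorsion_rpow m).convexOn.2 h₀ h₁ (sub_nonneg.2 ht.2) ht.1 (by ring)
  · intro n hn R₀ R₁ t h₀ h₁ ht
    obtain ⟨m, rfl⟩ := hsucc n hn
    refine ⟨fun h => ?_, ?_⟩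
    · by_contra hne
      exact ((strictConvexOn_ballTorsion_rpow m).2 h₀ h₁ hne (sub_pos.2 ht.2) ht.1 (by ring)).ne h
    · rintro rfl
      rw [← add_mul, ← add_mul, sub_add_cancel, one_mul, one_mul]
  · intro α h0 hα δ hδ
    obtain ⟨ρ, hρ, hc⟩ := exists_strictConcaveOn_ballTorsion_rpow h0 hα
    have hmin : 0 < min δ ρ := lt_min hδ hρ
    have hd : min δ ρ ≤ δ := min_le_left _ _
    have hr : min δ ρ ≤ ρ := min_le_right _ _
    -- Any two distinct radii below both `δ` and `ρ` would do; strict concavity is applied at their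
    -- midpoint.
    refine ⟨min δ ρ / 3, ⟨by linarith, by linarith⟩, min δ ρ / 2, ⟨by linarith, by linarith⟩,
      1 / 2, ⟨by norm_num, by norm_num⟩, ?_⟩
    exact hc.2 (x := min δ ρ / 3) (y := min δ ρ / 2) ⟨by linarith, by linarith⟩
      ⟨by linarith, by linarith⟩ (by linarith) (by norm_num) (by norm_num) (by norm_num)
  · intro n hn
    obtain ⟨m, rfl⟩ := hsucc n hn
    exact ⟨contDiffOn_ballTorsion m, fun R hR => deriv_ballTorsion_pos m hR⟩
  · rintro a ⟨n, hn, R, hR, rfl⟩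
    obtain ⟨m, rfl⟩ := hsucc n hn
    exact (threshold_lt m hR).le
  · intro b hb
    -- No threshold equals `1/3`; it is the least bound because the values for `n = 1` converge to
    -- it.
    refine le_of_tendsto tendsto_threshold_one ?_
    filter_upwards [self_mem_nhdsWithin] with R hR
    exact hb ⟨1, le_rfl, R, hR, rfl⟩
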